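/- All manifolds and Lie groups are smooth, real and finite-dimensional, without boundary. Let $G$ and $K$ be Lie groups with Lie algebras $\mathfrak g$ and $\mathfrak k$, let $\pi_P : P\to M$ be a principal $G$-bundle and $\pi_Q : Q\to M$ a principal $K$-bundle over the same manifold $M$ (with right actions). Let $$P\times_M Q=\{(p,q)\in P\times Q \mid \pi_P(p)=\pi_Q(q)\}$$ with projections $\phi_P : P\times_M Q\to P$ and $\phi_Q : P\times_M Q\to Q$; it is a principal $G\times K$-bundle over $M$ for the action $(p,q)\cdot(g,k)=(p\cdot g,q\cdot k)$. A principal connection on a principal $H$-bundle $R\to M$, where $H$ is a Lie group with Lie algebra $\mathfrak h$, is a smooth $\mathfrak h$-valued $1$-form $\omega$ on $R$ such that $\omega(\bar\xi)=\xi$ for every $\xi\in\mathfrak h$, where $\bar\xi_r=\frac{d}{dt}\big|_{t=0}\, r\cdot\exp(t\xi)$, and $R_h^*\omega=\mathrm{Ad}_{h^{-1}}\,\omega$ for every $h\in H$, where $R_h(r)=r\cdot h$. Then there is a natural bijection between pairs $(\omega,A)$, with $\omega$ a principal connection on $P$ and $A$ a principal connection on $Q$, and principal connections on the $G\times K$-bundle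 $P\times_M Q$. It sends $(\omega,A)$ to the $1$-form $\phi_P^*\omega\oplus\phi_Q^*A$ with values in $\mathfrak g\oplus\mathfrak k=\mathrm{Lie}(G\times K)$, that is, to the form whose $\mathfrak g$-component is $\phi_P^*\omega$ and whose $\mathfrak k$-component is $\phi_Q^*A$. -/

import Mathlib

open scoped Manifold ContDiff

noncomputable section

section Basic

variable {EG HG EP HP EM HM : Type*}
  [NormedAddCommGroup EG] [NormedSpace ℝ EG] [TopologicalSpace HG]
  [NormedAddCommGroup EP] [NormedSpace ℝ EP] [TopologicalSpace HP]
  [NormedAddCommGroup EM] [NormedSpace ℝ EM] [TopologicalSpace HM]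

/-- A smooth local trivialisation of `proj : P → M` that is equivariant for the right action
`act` of `G` on `P` and for right multiplication on the factor `G` of `M × G`. -/
structure IsPrincipalTriv
    (IG : ModelWithCorners ℝ EG HG) (IP : ModelWithCorners ℝ EP HP)
    (IM : ModelWithCorners ℝ EM HM)
    {G P M : Type*} [TopologicalSpace G] [ChartedSpace HG G] [Group G]
    [TopologicalSpace P] [ChartedSpace HP P] [TopologicalSpace M] [ChartedSpace HM M]
    {proj : P → M} (act : P → G → P) (e : Bundle.Trivialization G proj) : Prop where
  contMDiffOn : ContMDiffOn IP (IM.prod IG) ∞ e e.source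
  contMDiffOn_symm :
    ContMDiffOn (IM.prod IG) IP ∞ e.toOpenPartialHomeomorph.symm e.target
  equivariant : ∀ p ∈ e.source, ∀ g : G, (e (act p g)).2 = (e p).2 * g

/-- A smooth principal `G`-bundle `P → M`: a smooth projection, a smooth right action of `G`
preserving the fibres, and equivariant smooth local trivialisations around every point of `M`. -/
structure PrincipalBundle
    (IG : ModelWithCorners ℝ EG HG) (IP : ModelWithCorners ℝ EP HP)
    (IM : ModelWithCorners ℝ EM HM)
    (G P M : Type*) [TopologicalSpace G] [ChartedSpace HG G] [Group G]
    [TopologicalSpace P] [ChartedSpace HP P] [TopologicalSpace M] [ChartedSpace HM M] where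
  proj : P → M
  act : P → G → P
  act_one : ∀ p, act p 1 = p
  act_mul : ∀ p g h, act p (g * h) = act (act p g) h
  proj_act : ∀ p g, proj (act p g) = proj p
  contMDiff_proj : ContMDiff IP IM ∞ proj
  contMDiff_act : ContMDiff (IP.prod IG) IP ∞ (fun x : P × G => act x.1 x.2)
  exists_triv : ∀ m : M, ∃ e : Bundle.Trivialization G proj,
    m ∈ e.baseSet ∧ IsPrincipalTriv IG IP IM act e

/-- The pullback `f^* α` of a vector-valued `1`-form `α` on `Y` along `f : X → Y`:
`(f^* α)_x (v) = α_{f x} (df_x v)`. -/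
def pullbackForm {EX HX EY HY X Y V : Type*}
    [NormedAddCommGroup EX] [NormedSpace ℝ EX] [TopologicalSpace HX]
    [NormedAddCommGroup EY] [NormedSpace ℝ EY] [TopologicalSpace HY]
    (IX : ModelWithCorners ℝ EX HX) (IY : ModelWithCorners ℝ EY HY)
    [TopologicalSpace X] [ChartedSpace HX X] [TopologicalSpace Y] [ChartedSpace HY Y]
    [AddCommGroup V] [Module ℝ V] [TopologicalSpace V]
    (f : X → Y) (α : (y : Y) → TangentSpace IY y →L[ℝ] V) (x : X) : TangentSpace IX x →L[ℝ] V :=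
  (α (f x)).comp (mfderiv IX IY f x)

/-- The projection `𝔤 ⊕ 𝔨 = Lie (G × K) → 𝔤`, the differential of `G × K → G` at the identity. -/
def lieFst {EK HK : Type*} [NormedAddCommGroup EK] [NormedSpace ℝ EK] [TopologicalSpace HK]
    (IG : ModelWithCorners ℝ EG HG) (IK : ModelWithCorners ℝ EK HK)
    (G K : Type*) [TopologicalSpace G] [ChartedSpace HG G] [Group G]
    [TopologicalSpace K] [ChartedSpace HK K] [Group K] :
    GroupLieAlgebra (IG.prod IK) (G × K) →L[ℝ] GroupLieAlgebra IG G :=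
  mfderiv (IG.prod IK) IG (Prod.fst : G × K → G) 1

/-- The projection `𝔤 ⊕ 𝔨 = Lie (G × K) → 𝔨`, the differential of `G × K → K` at the identity. -/
def lieSnd {EK HK : Type*} [NormedAddCommGroup EK] [NormedSpace ℝ EK] [TopologicalSpace HK]
    (IG : ModelWithCorners ℝ EG HG) (IK : ModelWithCorners ℝ EK HK)
    (G K : Type*) [TopologicalSpace G] [ChartedSpace HG G] [Group G]
    [TopologicalSpace K] [ChartedSpace HK K] [Group K] :
    GroupLieAlgebra (IG.prod IK) (G × K) →L[ℝ] GroupLieAlgebra IK K :=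
  mfderiv (IG.prod IK) IK (Prod.snd : G × K → K) 1

/-- The adjoint action of `g` on the Lie algebra `𝔤 = T₁G`: the differential at `1` of the
conjugation `h ↦ g h g⁻¹`. -/
def lieAd (IG : ModelWithCorners ℝ EG HG)
    {G : Type*} [TopologicalSpace G] [ChartedSpace HG G] [Group G] (g : G) :
    GroupLieAlgebra IG G →L[ℝ] GroupLieAlgebra IG G :=
  mfderiv IG IG (fun h : G => g * h * g⁻¹) 1

namespace PrincipalBundle

variable {IG : ModelWithCorners ℝ EG HG} {IP : ModelWithCorners ℝ EP HP}
  {IM : ModelWithCorners ℝ EM HM}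
  {G P M : Type*} [TopologicalSpace G] [ChartedSpace HG G] [Group G]
  [TopologicalSpace P] [ChartedSpace HP P] [TopologicalSpace M] [ChartedSpace HM M]

/-- The fundamental vector field `ξ̄` on `P`: the differential at `1` of the orbit map
`g ↦ p · g`, applied to `ξ ∈ 𝔤`. -/
def fundamentalField (B : PrincipalBundle IG IP IM G P M) (ξ : GroupLieAlgebra IG G) (p : P) :
    TangentSpace IP p :=
  (mfderiv IG IP (fun g : G => B.act p g) 1 ξ : EP)

end PrincipalBundle

/-- A `G`-principal connection `1`-form on a principal bundle: a smooth `𝔤`-valued `1`-form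
(a smooth map `TP → 𝔤` that is linear on each tangent space) which is normalised on the
fundamental vector fields and satisfies `R_g^* ω = Ad_{g⁻¹} ω`. -/
@[ext]
structure PrincipalConnection
    {IG : ModelWithCorners ℝ EG HG} {IP : ModelWithCorners ℝ EP HP}
    {IM : ModelWithCorners ℝ EM HM}
    {G P M : Type*} [TopologicalSpace G] [ChartedSpace HG G] [Group G]
    [TopologicalSpace P] [ChartedSpace HP P] [IsManifold IP ∞ P]
    [TopologicalSpace M] [ChartedSpace HM M]
    (B : PrincipalBundle IG IP IM G P M) where
  form : (p : P) → TangentSpace IP p →L[ℝ] GroupLieAlgebra IG G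
  contMDiff_form :
    ContMDiff (M' := EG) IP.tangent 𝓘(ℝ, EG) ∞ (fun v : TangentBundle IP P => form v.1 v.2)
  normalised : ∀ (p : P) (ξ : GroupLieAlgebra IG G), form p (B.fundamentalField ξ p) = ξ
  equivariant : ∀ (g : G) (p : P) (v : TangentSpace IP p),
    form (B.act p g) (mfderiv IP IP (fun x : P => B.act x g) p v) = lieAd IG g⁻¹ (form p v)

end Basic

section FibreProduct

variable {EG HG EK HK EP HP EQ HQ EM HM : Type*}
  [NormedAddCommGroup EG] [NormedSpace ℝ EG] [TopologicalSpace HG]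
  [NormedAddCommGroup EK] [NormedSpace ℝ EK] [TopologicalSpace HK]
  [NormedAddCommGroup EP] [NormedSpace ℝ EP] [TopologicalSpace HP]
  [NormedAddCommGroup EQ] [NormedSpace ℝ EQ] [TopologicalSpace HQ]
  [NormedAddCommGroup EM] [NormedSpace ℝ EM] [TopologicalSpace HM]
  {IG : ModelWithCorners ℝ EG HG} {IK : ModelWithCorners ℝ EK HK}
  {IP : ModelWithCorners ℝ EP HP} {IQ : ModelWithCorners ℝ EQ HQ}
  {IM : ModelWithCorners ℝ EM HM}
  {G K P Q M : Type*}
  [TopologicalSpace G] [ChartedSpace HG G] [Group G]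
  [TopologicalSpace K] [ChartedSpace HK K] [Group K]
  [TopologicalSpace P] [ChartedSpace HP P]
  [TopologicalSpace Q] [ChartedSpace HQ Q]
  [TopologicalSpace M] [ChartedSpace HM M]

/-- The fibre product `P ×_M Q = {(p, q) ∈ P × Q | π_P p = π_Q q}`. -/
@[ext]
structure FibreProduct (B : PrincipalBundle IG IP IM G P M)
    (C : PrincipalBundle IK IQ IM K Q M) where
  fst : P
  snd : Q
  proj_eq : B.proj fst = C.proj snd

namespace FibreProduct

variable {B : PrincipalBundle IG IP IM G P M} {C : PrincipalBundle IK IQ IM K Q M}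

/-- The inclusion `P ×_M Q → P × Q`. -/
def toProd (x : FibreProduct B C) : P × Q := (x.fst, x.snd)

/-- The topology of `P ×_M Q` is the one of a subspace of `P × Q`. -/
instance : TopologicalSpace (FibreProduct B C) := TopologicalSpace.induced toProd inferInstance

theorem isInducing_toProd : Topology.IsInducing (toProd : FibreProduct B C → P × Q) := ⟨rfl⟩

theorem continuous_fst : Continuous (fst : FibreProduct B C → P) :=
  _root_.continuous_fst.comp isInducing_toProd.continuous

theorem continuous_snd : Continuous (snd : FibreProduct B C → Q) :=
  _root_.continuous_snd.comp isInducing_toProd.continuous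

theorem exists_point (B : PrincipalBundle IG IP IM G P M) (C : PrincipalBundle IK IQ IM K Q M)
    (m : M) : ∃ x : FibreProduct B C, B.proj x.fst = m := by
  obtain ⟨e, he, -⟩ := B.exists_triv m
  obtain ⟨e', he', -⟩ := C.exists_triv m
  have h1 := e.proj_symm_apply' (x := (1 : G)) he
  have h2 := e'.proj_symm_apply' (x := (1 : K)) he'
  exact ⟨⟨e.toOpenPartialHomeomorph.symm (m, 1), e'.toOpenPartialHomeomorph.symm (m, 1),
    h1.trans h2.symm⟩, h1⟩

open Classical in
/-- The map `(m, (g, k)) ↦ (p, q)` inverse to the local trivialisation below; its values outside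
the common base set are irrelevant. -/
def trivInv (e : Bundle.Trivialization G B.proj) (e' : Bundle.Trivialization K C.proj)
    (y : M × (G × K)) : FibreProduct B C :=
  if h : y.1 ∈ e.baseSet ∧ y.1 ∈ e'.baseSet then
    ⟨e.toOpenPartialHomeomorph.symm (y.1, y.2.1), e'.toOpenPartialHomeomorph.symm (y.1, y.2.2),
      (e.proj_symm_apply' h.1).trans (e'.proj_symm_apply' h.2).symm⟩
  else (exists_point B C y.1).choose

theorem fst_trivInv (e : Bundle.Trivialization G B.proj) (e' : Bundle.Trivialization K C.proj)
    {y : M × (G × K)} (h : y.1 ∈ e.baseSet ∩ e'.baseSet) :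
    (trivInv e e' y).fst = e.toOpenPartialHomeomorph.symm (y.1, y.2.1) := by
  rw [trivInv, dif_pos ⟨h.1, h.2⟩]

theorem snd_trivInv (e : Bundle.Trivialization G B.proj) (e' : Bundle.Trivialization K C.proj)
    {y : M × (G × K)} (h : y.1 ∈ e.baseSet ∩ e'.baseSet) :
    (trivInv e e' y).snd = e'.toOpenPartialHomeomorph.symm (y.1, y.2.2) := by
  rw [trivInv, dif_pos ⟨h.1, h.2⟩]

/-- The local trivialisation `(p, q) ↦ (m, (g, k))` of `P ×_M Q` over the intersection of the base
sets of trivialisations `p ↦ (m, g)` of `P` and `q ↦ (m, k)` of `Q`. -/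
def triv (e : Bundle.Trivialization G B.proj) (e' : Bundle.Trivialization K C.proj) :
    Bundle.Trivialization (G × K) (fun x : FibreProduct B C => B.proj x.fst) where
  toFun x := (B.proj x.fst, ((e x.fst).2, (e' x.snd).2))
  invFun := trivInv e e'
  source := (fun x : FibreProduct B C => B.proj x.fst) ⁻¹' (e.baseSet ∩ e'.baseSet)
  target := (e.baseSet ∩ e'.baseSet) ×ˢ Set.univ
  map_source' x hx := ⟨hx, trivial⟩
  map_target' y hy := by
    rw [Set.mem_preimage, fst_trivInv e e' hy.1, e.proj_symm_apply' hy.1.1]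
    exact hy.1
  left_inv' x hx := by
    apply FibreProduct.ext
    · rw [fst_trivInv e e' (Set.mem_preimage.1 hx)]
      exact e.symm_apply_mk_proj (e.mem_source.2 hx.1)
    · rw [snd_trivInv e e' (Set.mem_preimage.1 hx), x.proj_eq]
      exact e'.symm_apply_mk_proj (e'.mem_source.2 (x.proj_eq ▸ (Set.mem_preimage.1 hx).2))
  right_inv' y hy := by
    rw [fst_trivInv e e' hy.1, snd_trivInv e e' hy.1, e.apply_symm_apply' hy.1.1,
      e'.apply_symm_apply' hy.1.2, e.proj_symm_apply' hy.1.1]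
  open_source := (e.open_baseSet.inter e'.open_baseSet).preimage
    (B.contMDiff_proj.continuous.comp continuous_fst)
  open_target := (e.open_baseSet.inter e'.open_baseSet).prod isOpen_univ
  continuousOn_toFun := by
    have h1 : ContinuousOn (e ∘ (fst : FibreProduct B C → P))
        ((fun x : FibreProduct B C => B.proj x.fst) ⁻¹' (e.baseSet ∩ e'.baseSet)) :=
      ContinuousOn.comp e.continuousOn_toFun continuous_fst.continuousOn
        (fun x hx => (Set.mem_preimage.trans e.mem_source).2 (Set.mem_preimage.1 hx).1)
    have h2 : ContinuousOn (e' ∘ (snd : FibreProduct B C → Q))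
        ((fun x : FibreProduct B C => B.proj x.fst) ⁻¹' (e.baseSet ∩ e'.baseSet)) :=
      ContinuousOn.comp e'.continuousOn_toFun continuous_snd.continuousOn
        (fun x hx => e'.mem_source.2 (x.proj_eq ▸ (Set.mem_preimage.1 hx).2))
    exact (B.contMDiff_proj.continuous.comp continuous_fst).continuousOn.prodMk
      (h1.snd.prodMk h2.snd)
  continuousOn_invFun := by
    refine isInducing_toProd.continuousOn_iff.2 ?_
    have h1 : ContinuousOn
        (e.toOpenPartialHomeomorph.symm ∘ fun y : M × (G × K) => (y.1, y.2.1))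
        ((e.baseSet ∩ e'.baseSet) ×ˢ Set.univ) :=
      e.toOpenPartialHomeomorph.continuousOn_symm.comp (by fun_prop)
        (fun y hy => e.mem_target.2 hy.1.1)
    have h2 : ContinuousOn
        (e'.toOpenPartialHomeomorph.symm ∘ fun y : M × (G × K) => (y.1, y.2.2))
        ((e.baseSet ∩ e'.baseSet) ×ˢ Set.univ) :=
      e'.toOpenPartialHomeomorph.continuousOn_symm.comp (by fun_prop)
        (fun y hy => e'.mem_target.2 hy.1.2)
    exact (h1.prodMk h2).congr fun y hy =>
      Prod.ext (fst_trivInv e e' hy.1) (snd_trivInv e e' hy.1)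
  baseSet := e.baseSet ∩ e'.baseSet
  open_baseSet := e.open_baseSet.inter e'.open_baseSet
  source_eq := rfl
  target_eq := rfl
  proj_toFun _ _ := rfl

/-- The charts of `P ×_M Q`: a local trivialisation to `M × (G × K)` obtained from equivariant
smooth trivialisations of `P` and `Q`, followed by a chart of `M × (G × K)`. -/
instance : ChartedSpace (ModelProd HM (ModelProd HG HK)) (FibreProduct B C) where
  atlas := {φ | ∃ (e : Bundle.Trivialization G B.proj) (e' : Bundle.Trivialization K C.proj)
    (c : OpenPartialHomeomorph (M × (G × K)) (ModelProd HM (ModelProd HG HK))),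
    IsPrincipalTriv IG IP IM B.act e ∧ IsPrincipalTriv IK IQ IM C.act e' ∧
    c ∈ atlas (ModelProd HM (ModelProd HG HK)) (M × (G × K)) ∧
    φ = (triv e e').toOpenPartialHomeomorph.trans c}
  chartAt x :=
    (triv (B.exists_triv (B.proj x.fst)).choose
      (C.exists_triv (B.proj x.fst)).choose).toOpenPartialHomeomorph.trans
      (chartAt (ModelProd HM (ModelProd HG HK))
        (triv (B.exists_triv (B.proj x.fst)).choose (C.exists_triv (B.proj x.fst)).choose x))
  mem_chart_source x := by
    refine ⟨⟨(B.exists_triv _).choose_spec.1, (C.exists_triv _).choose_spec.1⟩, ?_⟩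
    rw [Set.mem_preimage]
    exact mem_chart_source (ModelProd HM (ModelProd HG HK)) (M := M × (G × K)) _
  chart_mem_atlas x := ⟨_, _, _, (B.exists_triv _).choose_spec.2, (C.exists_triv _).choose_spec.2,
    chart_mem_atlas _ _, rfl⟩

/-- The transition maps between the local trivialisations of `P ×_M Q` are smooth. -/
theorem contMDiffOn_transition
    {e₁ e₂ : Bundle.Trivialization G B.proj} {e₁' e₂' : Bundle.Trivialization K C.proj}
    (h₁ : IsPrincipalTriv IG IP IM B.act e₁) (h₂ : IsPrincipalTriv IG IP IM B.act e₂)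
    (h₁' : IsPrincipalTriv IK IQ IM C.act e₁') (h₂' : IsPrincipalTriv IK IQ IM C.act e₂') :
    ContMDiffOn (IM.prod (IG.prod IK)) (IM.prod (IG.prod IK)) ∞
      (fun y => triv e₂ e₂' ((triv e₁ e₁').toOpenPartialHomeomorph.symm y))
      (((e₁.baseSet ∩ e₁'.baseSet) ∩ (e₂.baseSet ∩ e₂'.baseSet)) ×ˢ Set.univ) := by
  set s : Set (M × (G × K)) :=
    ((e₁.baseSet ∩ e₁'.baseSet) ∩ (e₂.baseSet ∩ e₂'.baseSet)) ×ˢ Set.univ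
  have f1 : ContMDiffOn (IM.prod (IG.prod IK)) (IM.prod IG) ∞
      (fun y : M × (G × K) => (y.1, y.2.1)) s :=
    (contMDiff_fst.prodMk (contMDiff_fst.comp contMDiff_snd)).contMDiffOn
  have f2 : ContMDiffOn (IM.prod (IG.prod IK)) (IM.prod IK) ∞
      (fun y : M × (G × K) => (y.1, y.2.2)) s :=
    (contMDiff_fst.prodMk (contMDiff_snd.comp contMDiff_snd)).contMDiffOn
  have a1 := h₁.contMDiffOn_symm.comp f1 (fun y hy => e₁.mem_target.2 hy.1.1.1)
  have a2 := h₁'.contMDiffOn_symm.comp f2 (fun y hy => e₁'.mem_target.2 hy.1.1.2)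
  have b1 := h₂.contMDiffOn.comp a1 (fun y hy => by
    rw [Set.mem_preimage, e₂.mem_source, Function.comp_apply, e₁.proj_symm_apply' hy.1.1.1]
    exact hy.1.2.1)
  have b2 := h₂'.contMDiffOn.comp a2 (fun y hy => by
    rw [Set.mem_preimage, e₂'.mem_source, Function.comp_apply, e₁'.proj_symm_apply' hy.1.1.2]
    exact hy.1.2.2)
  refine (contMDiff_fst.contMDiffOn.prodMk
    ((contMDiff_snd.comp_contMDiffOn b1).prodMk (contMDiff_snd.comp_contMDiffOn b2))).congr
    fun y hy => ?_
  change (B.proj (trivInv e₁ e₁' y).fst,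
    ((e₂ (trivInv e₁ e₁' y).fst).2, (e₂' (trivInv e₁ e₁' y).snd).2)) = _
  rw [fst_trivInv e₁ e₁' hy.1.1, snd_trivInv e₁ e₁' hy.1.1, e₁.proj_symm_apply' hy.1.1.1]
  rfl

theorem mem_source_triv {e : Bundle.Trivialization G B.proj} {e' : Bundle.Trivialization K C.proj}
    {x : FibreProduct B C} (h : B.proj x.fst ∈ e.baseSet) (h' : B.proj x.fst ∈ e'.baseSet) :
    x ∈ (triv e e').source :=
  (triv e e').mem_source.2 ⟨h, h'⟩

variable [IsManifold IM ∞ M] [LieGroup IG ∞ G] [LieGroup IK ∞ K]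

/-- `P ×_M Q` is a smooth manifold. -/
instance : IsManifold (IM.prod (IG.prod IK)) ∞ (FibreProduct B C) := by
  refine isManifold_of_contDiffOn _ _ _ ?_
  rintro _ _ ⟨e₁, e₁', c₁, h₁, h₁', hc₁, rfl⟩ ⟨e₂, e₂', c₂, h₂, h₂', hc₂, rfl⟩
  have k₁ := contMDiffOn_symm_of_mem_maximalAtlas (I := IM.prod (IG.prod IK)) (n := ∞)
    (IsManifold.subset_maximalAtlas hc₁)
  have k₂ := contMDiffOn_of_mem_maximalAtlas (I := IM.prod (IG.prod IK)) (n := ∞)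
    (IsManifold.subset_maximalAtlas hc₂)
  have kt := contMDiffOn_transition h₁ h₂ h₁' h₂'
  rw [← contMDiffOn_iff_contDiffOn]
  apply (IM.prod (IG.prod IK)).contMDiff.comp_contMDiffOn
  set I := IM.prod (IG.prod IK)
  set τ₁ := (triv e₁ e₁').toOpenPartialHomeomorph with hτ₁
  set τ₂ := (triv e₂ e₂').toOpenPartialHomeomorph with hτ₂
  have key : ∀ y ∈ (τ₁.symm.trans τ₂).source,
      y ∈ (((e₁.baseSet ∩ e₁'.baseSet) ∩ (e₂.baseSet ∩ e₂'.baseSet)) ×ˢ Set.univ :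
        Set (M × (G × K))) := by
    rintro y ⟨hy, hy'⟩
    have h1 := (triv e₁ e₁').mem_target.1 hy
    have h2 : B.proj (τ₁.symm y).fst ∈ (triv e₂ e₂').baseSet :=
      (triv e₂ e₂').mem_source.1 (Set.mem_preimage.1 hy')
    have h3 : B.proj (τ₁.symm y).fst = y.1 := (triv e₁ e₁').proj_symm_apply hy
    rw [h3] at h2
    exact ⟨⟨h1, h2⟩, trivial⟩
  have k : ContMDiffOn I I ∞ (c₂ ∘ (fun y => τ₂ (τ₁.symm y)) ∘ c₁.symm)
      ((τ₁.trans c₁).symm.trans (τ₂.trans c₂)).source := by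
    refine k₂.comp (kt.comp (k₁.mono ?_) ?_) ?_
    · intro z hz
      exact hz.1.1
    · intro z hz
      exact key _ ⟨hz.1.2, hz.2.1⟩
    · intro z hz
      exact hz.2.2
  exact k.comp (I.contMDiffOn_symm.mono Set.inter_subset_right) (fun z hz => hz.1)

theorem contMDiffOn_triv
    {e : Bundle.Trivialization G B.proj} {e' : Bundle.Trivialization K C.proj}
    (h : IsPrincipalTriv IG IP IM B.act e) (h' : IsPrincipalTriv IK IQ IM C.act e') :
    ContMDiffOn (IM.prod (IG.prod IK)) (IM.prod (IG.prod IK)) ∞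
      (triv e e') (triv e e').source := by
  intro x hx
  set c := chartAt (ModelProd HM (ModelProd HG HK)) (triv e e' x) with hc
  set φ := (triv e e').toOpenPartialHomeomorph.trans c with hφ
  have hφa : φ ∈ IsManifold.maximalAtlas (IM.prod (IG.prod IK)) ∞ (FibreProduct B C) :=
    IsManifold.subset_maximalAtlas ⟨e, e', c, h, h', chart_mem_atlas _ _, rfl⟩
  have hxφ : x ∈ φ.source := ⟨hx, Set.mem_preimage.2
    (mem_chart_source (ModelProd HM (ModelProd HG HK)) (triv e e' x))⟩
  have h1 := contMDiffOn_of_mem_maximalAtlas hφa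
  have h2 : ContMDiffOn (IM.prod (IG.prod IK)) (IM.prod (IG.prod IK)) ∞ c.symm c.target :=
    contMDiffOn_chart_symm
  have h3 := h2.comp h1 (fun y hy => c.map_source hy.2)
  have h4 : ContMDiffOn (IM.prod (IG.prod IK)) (IM.prod (IG.prod IK)) ∞ (triv e e') φ.source :=
    h3.congr fun y hy => (c.left_inv hy.2).symm
  exact (h4.contMDiffAt (φ.open_source.mem_nhds hxφ)).contMDiffWithinAt

theorem contMDiffOn_triv_symm
    {e : Bundle.Trivialization G B.proj} {e' : Bundle.Trivialization K C.proj}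
    (h : IsPrincipalTriv IG IP IM B.act e) (h' : IsPrincipalTriv IK IQ IM C.act e') :
    ContMDiffOn (IM.prod (IG.prod IK)) (IM.prod (IG.prod IK)) ∞
      (triv e e').toOpenPartialHomeomorph.symm (triv e e').target := by
  intro y hy
  set c := chartAt (ModelProd HM (ModelProd HG HK)) y with hc
  set φ := (triv e e').toOpenPartialHomeomorph.trans c with hφ
  have hφa : φ ∈ IsManifold.maximalAtlas (IM.prod (IG.prod IK)) ∞ (FibreProduct B C) :=
    IsManifold.subset_maximalAtlas ⟨e, e', c, h, h', chart_mem_atlas _ _, rfl⟩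
  have h1 := contMDiffOn_symm_of_mem_maximalAtlas hφa
  have h2 : ContMDiffOn (IM.prod (IG.prod IK)) (IM.prod (IG.prod IK)) ∞ c c.source :=
    contMDiffOn_chart
  have h3 := h1.comp (h2.mono (Set.inter_subset_right (s := (triv e e').target)))
    (fun z hz => by
      refine ⟨c.map_source hz.2, ?_⟩
      rw [Set.mem_preimage, c.left_inv hz.2]
      exact hz.1)
  have h4 : ContMDiffOn (IM.prod (IG.prod IK)) (IM.prod (IG.prod IK)) ∞
      (triv e e').toOpenPartialHomeomorph.symm ((triv e e').target ∩ c.source) :=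
    h3.congr fun z hz => congrArg _ (c.left_inv hz.2).symm
  exact (h4.contMDiffAt (((triv e e').open_target.inter c.open_source).mem_nhds
    ⟨hy, mem_chart_source _ _⟩)).contMDiffWithinAt

/-- The projection `φ_P : P ×_M Q → P` is smooth. -/
theorem contMDiff_fst : ContMDiff (IM.prod (IG.prod IK)) IP ∞ (fst : FibreProduct B C → P) := by
  intro x
  obtain ⟨e, he, h⟩ := B.exists_triv (B.proj x.fst)
  obtain ⟨e', he', h'⟩ := C.exists_triv (B.proj x.fst)
  have h1 := contMDiffOn_triv h h'
  have h2 : ContMDiff (IM.prod (IG.prod IK)) (IM.prod IG) ∞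
      (fun y : M × (G × K) => (y.1, y.2.1)) :=
    _root_.contMDiff_fst.prodMk (_root_.contMDiff_fst.comp _root_.contMDiff_snd)
  have h3 := h.contMDiffOn_symm.comp (h2.comp_contMDiffOn h1)
    (fun y hy => e.mem_target.2 ((triv e e').mem_source.1 hy).1)
  refine (h3.congr fun y hy => ?_).contMDiffAt
    ((triv e e').open_source.mem_nhds (mem_source_triv he he'))
  exact (e.symm_apply_mk_proj (e.mem_source.2 ((triv e e').mem_source.1 hy).1)).symm

/-- The projection `φ_Q : P ×_M Q → Q` is smooth. -/
theorem contMDiff_snd : ContMDiff (IM.prod (IG.prod IK)) IQ ∞ (snd : FibreProduct B C → Q) := by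
  intro x
  obtain ⟨e, he, h⟩ := B.exists_triv (B.proj x.fst)
  obtain ⟨e', he', h'⟩ := C.exists_triv (B.proj x.fst)
  have h1 := contMDiffOn_triv h h'
  have h2 : ContMDiff (IM.prod (IG.prod IK)) (IM.prod IK) ∞
      (fun y : M × (G × K) => (y.1, y.2.2)) :=
    _root_.contMDiff_fst.prodMk (_root_.contMDiff_snd.comp _root_.contMDiff_snd)
  have h3 := h'.contMDiffOn_symm.comp (h2.comp_contMDiffOn h1)
    (fun y hy => e'.mem_target.2 ((triv e e').mem_source.1 hy).2)
  refine (h3.congr fun y hy => ?_).contMDiffAt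
    ((triv e e').open_source.mem_nhds (mem_source_triv he he'))
  have hy' : C.proj y.snd ∈ e'.baseSet := y.proj_eq ▸ ((triv e e').mem_source.1 hy).2
  change y.snd = e'.toOpenPartialHomeomorph.symm (B.proj y.fst, (e' y.snd).2)
  rw [y.proj_eq]
  exact (e'.symm_apply_mk_proj (e'.mem_source.2 hy')).symm

/-- A map into `P ×_M Q` is smooth if its components are: with the smoothness of the projections,
this says that `P ×_M Q` is the fibre product in the category of smooth manifolds. -/
theorem contMDiff_of_components {EN HN N : Type*} [NormedAddCommGroup EN] [NormedSpace ℝ EN]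
    [TopologicalSpace HN] {IN : ModelWithCorners ℝ EN HN} [TopologicalSpace N] [ChartedSpace HN N]
    {f : N → FibreProduct B C} (h₁ : ContMDiff IN IP ∞ (fun z => (f z).fst))
    (h₂ : ContMDiff IN IQ ∞ (fun z => (f z).snd)) : ContMDiff IN (IM.prod (IG.prod IK)) ∞ f := by
  intro z
  obtain ⟨e, he, h⟩ := B.exists_triv (B.proj (f z).fst)
  obtain ⟨e', he', h'⟩ := C.exists_triv (B.proj (f z).fst)
  have hp := B.contMDiff_proj.comp h₁
  have hs : IsOpen ((fun w => B.proj (f w).fst) ⁻¹' (e.baseSet ∩ e'.baseSet)) :=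
    (e.open_baseSet.inter e'.open_baseSet).preimage hp.continuous
  set s := (fun w => B.proj (f w).fst) ⁻¹' (e.baseSet ∩ e'.baseSet) with hs_def
  have a1 := h.contMDiffOn.comp (h₁.contMDiffOn (s := s))
    (fun w hw => e.mem_source.2 (Set.mem_preimage.1 hw).1)
  have a2 := h'.contMDiffOn.comp (h₂.contMDiffOn (s := s))
    (fun w hw => e'.mem_source.2 ((f w).proj_eq ▸ (Set.mem_preimage.1 hw).2))
  have a3 := hp.contMDiffOn.prodMk ((_root_.contMDiff_snd.comp_contMDiffOn a1).prodMk
    (_root_.contMDiff_snd.comp_contMDiffOn a2))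
  have a4 := (contMDiffOn_triv_symm h h').comp a3
    (fun w hw => (triv e e').mem_target.2 (Set.mem_preimage.1 hw))
  refine (a4.congr fun w hw => ?_).contMDiffAt (hs.mem_nhds ⟨he, he'⟩)
  exact ((triv e e').left_inv ((triv e e').mem_source.2 (Set.mem_preimage.1 hw))).symm

end FibreProduct

/-- `P ×_M Q → M` as a principal bundle with group `G × K`, acting by
`(p, q) · (g, k) = (p · g, q · k)`. -/
def PrincipalBundle.fibreProduct [IsManifold IM ∞ M] [LieGroup IG ∞ G] [LieGroup IK ∞ K]
    (B : PrincipalBundle IG IP IM G P M) (C : PrincipalBundle IK IQ IM K Q M) :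
    PrincipalBundle (IG.prod IK) (IM.prod (IG.prod IK)) IM (G × K) (FibreProduct B C) M where
  proj x := B.proj x.fst
  act x a := ⟨B.act x.fst a.1, C.act x.snd a.2, by rw [B.proj_act, C.proj_act, x.proj_eq]⟩
  act_one x := FibreProduct.ext (B.act_one _) (C.act_one _)
  act_mul x a b := FibreProduct.ext (B.act_mul _ _ _) (C.act_mul _ _ _)
  proj_act x a := B.proj_act _ _
  contMDiff_proj := B.contMDiff_proj.comp FibreProduct.contMDiff_fst
  contMDiff_act := FibreProduct.contMDiff_of_components
    (B.contMDiff_act.comp ((FibreProduct.contMDiff_fst.comp contMDiff_fst).prodMk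
      (contMDiff_fst.comp contMDiff_snd)))
    (C.contMDiff_act.comp ((FibreProduct.contMDiff_snd.comp contMDiff_fst).prodMk
      (contMDiff_snd.comp contMDiff_snd)))
  exists_triv m := by
    obtain ⟨e, he, h⟩ := B.exists_triv m
    obtain ⟨e', he', h'⟩ := C.exists_triv m
    refine ⟨FibreProduct.triv e e', ⟨he, he'⟩, FibreProduct.contMDiffOn_triv h h',
      FibreProduct.contMDiffOn_triv_symm h h', fun x hx a => ?_⟩
    have hx' := (FibreProduct.triv e e').mem_source.1 hx
    exact Prod.ext (h.equivariant _ (e.mem_source.2 hx'.1) _)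
      (h'.equivariant _ (e'.mem_source.2 (x.proj_eq ▸ hx'.2)) _)

end FibreProduct

end

/-! The form `φ_P^*ω ⊕ φ_Q^*A` is a connection because both projections are equivariant bundle maps
along the projections of `G × K`. The substance is the converse: the `𝔤`-component of any connection
`Ω` on `P ×_M Q` descends to `P`, and likewise its `𝔨`-component to `Q`.

Consider generally a bundle map `π : R → P` along `φ : H → G` with local sections `σ`, and write `r
= σ(π r) · κ(r)` with `φ(κ) = 1`. The Leibniz rule gives `Ω(v) = Ad_{κ⁻¹} Ω(dσ dπ v) + κ⁻¹ dκ(v)`.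
Since `dφ` intertwines the adjoint actions and `φ ∘ κ` is constant, applying `dφ` leaves `dφ Ω(v) =
dφ Ω(dσ dπ v)`. Thus `dφ ∘ Ω` depends only on `dπ v`: it is the pullback of a form on `P`, locally
`σ^*(dφ ∘ Ω)` (`hom_form_eq`). A homomorphic section `ι` of `φ` lifts group and Lie algebra
elements, so the axioms for `Ω` yield those of the descended form (`exists_pushforward`).

Local sections also make `π` and each `dπ` surjective, so pullback is injective on connections
(`connection_ext`). For `P ×_M Q → P`, a local section of `Q` supplies `σ`, and `κ` is the
`K`-coordinate of `q` relative to it. -/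

noncomputable section

/-! ### Maurer-Cartan form and the differential of a principal action. -/

section PrincipalConnections

variable {EG HG EP HP EM HM EH HH ER HR EN HN : Type*}
  [NormedAddCommGroup EG] [NormedSpace ℝ EG] [TopologicalSpace HG]
  [NormedAddCommGroup EP] [NormedSpace ℝ EP] [TopologicalSpace HP]
  [NormedAddCommGroup EM] [NormedSpace ℝ EM] [TopologicalSpace HM]
  [NormedAddCommGroup EH] [NormedSpace ℝ EH] [TopologicalSpace HH]
  [NormedAddCommGroup ER] [NormedSpace ℝ ER] [TopologicalSpace HR]
  [NormedAddCommGroup EN] [NormedSpace ℝ EN] [TopologicalSpace HN]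
  {IG : ModelWithCorners ℝ EG HG} {IP : ModelWithCorners ℝ EP HP}
  {IM : ModelWithCorners ℝ EM HM} {IH : ModelWithCorners ℝ EH HH}
  {IR : ModelWithCorners ℝ ER HR} {IN : ModelWithCorners ℝ EN HN}
  {G P M H R N : Type*}
  [TopologicalSpace G] [ChartedSpace HG G] [Group G]
  [TopologicalSpace P] [ChartedSpace HP P]
  [TopologicalSpace M] [ChartedSpace HM M]
  [TopologicalSpace H] [ChartedSpace HH H] [Group H]
  [TopologicalSpace R] [ChartedSpace HR R]
  [TopologicalSpace N] [ChartedSpace HN N]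

/-- The left-invariant Maurer-Cartan form `w ↦ g⁻¹ w` on a Lie group. -/
def maurerCartan (IG : ModelWithCorners ℝ EG HG) (g : G) :
    TangentSpace IG g →L[ℝ] GroupLieAlgebra IG G :=
  -- The derivative lands in the tangent space at `g⁻¹ * g`; it is read in `T₁G`, as every tangent
  -- space is the model space `EG`.
  (mfderiv IG IG (fun a : G => g⁻¹ * a) g : EG →L[ℝ] EG)

theorem lieAd_one (ξ : GroupLieAlgebra IG G) : lieAd IG (1 : G) ξ = ξ := by
  have h : (fun h : G => 1 * h * 1⁻¹) = id := by
    funext h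
    simp
  rw [lieAd, h, mfderiv_id]
  rfl

theorem mdifferentiableAt_leftMul [LieGroup IG ∞ G] (g a : G) :
    MDifferentiableAt IG IG (fun b : G => g * b) a :=
  (contMDiff_mul_left (I := IG) (n := ∞) (a := g)).mdifferentiable (by simp) a

namespace PrincipalBundle

theorem mdifferentiableAt_act (B : PrincipalBundle IG IP IM G P M) (x : P × G) :
    MDifferentiableAt (IP.prod IG) IP (fun x : P × G => B.act x.1 x.2) x :=
  B.contMDiff_act.mdifferentiable (by simp) x

theorem mdifferentiableAt_act_left (B : PrincipalBundle IG IP IM G P M) (g : G) (p : P) :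
    MDifferentiableAt IP IP (fun x : P => B.act x g) p :=
  (B.mdifferentiableAt_act (p, g)).comp p (mdifferentiableAt_id.prodMk mdifferentiableAt_const)

theorem mdifferentiableAt_act_right (B : PrincipalBundle IG IP IM G P M) (p : P) (g : G) :
    MDifferentiableAt IG IP (fun a : G => B.act p a) g :=
  (B.mdifferentiableAt_act (p, g)).comp g (mdifferentiableAt_const.prodMk mdifferentiableAt_id)

/-- The Leibniz rule for the action, applied to a moving point and a moving group element. -/
theorem mfderiv_act_apply (B : PrincipalBundle IG IP IM G P M) {f : N → P} {a : N → G} {n : N}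
    (hf : MDifferentiableAt IN IP f n) (ha : MDifferentiableAt IN IG a n) (v : EN) :
    (mfderiv IN IP (fun z => B.act (f z) (a z)) n v : EP) =
      (mfderiv IP IP (fun x : P => B.act x (a n)) (f n) (mfderiv IN IP f n v : EP) : EP) +
      (mfderiv IG IP (fun g : G => B.act (f n) g) (a n) (mfderiv IN IG a n v : EG) : EP) := by
  have h := mfderiv_comp_apply n (B.mdifferentiableAt_act (f n, a n)) (hf.prodMk ha) v
  rw [mfderiv_prodMk hf ha, mfderiv_prod_eq_add_apply (B.mdifferentiableAt_act (f n, a n))] at h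
  exact h

/-- The differential of an orbit map at an arbitrary group element, in terms of fundamental
vectors. -/
theorem mfderiv_orbit_apply [LieGroup IG ∞ G] (B : PrincipalBundle IG IP IM G P M) (p : P) (g : G)
    (w : EG) :
    (mfderiv IG IP (fun a : G => B.act p a) g w : EP) =
      B.fundamentalField (maurerCartan IG g w) (B.act p g) := by
  have h := mfderiv_comp_apply_of_eq (x := g) (y := (1 : G))
    (B.mdifferentiableAt_act_right (B.act p g) 1) (mdifferentiableAt_leftMul g⁻¹ g) (by simp) w
  -- Writing `p · a = (p · g) · (g⁻¹ a)` moves the derivative at `g` to one at `1`, based at `p ·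
  -- g`.
  have he : (fun a : G => B.act (B.act p g) a) ∘ (fun a : G => g⁻¹ * a) = fun a => B.act p a := by
    funext a
    simp [← B.act_mul]
  rw [he] at h
  exact h

/-! ### Equivariant bundle maps and their differentials. -/

/-- A smooth map between principal bundles, equivariant along a smooth group homomorphism. -/
structure IsMorphism (D : PrincipalBundle IH IR IM H R M) (B : PrincipalBundle IG IP IM G P M)
    (φ : H →* G) (π : R → P) : Prop where
  contMDiff : ContMDiff IR IP ∞ π
  contMDiff_hom : ContMDiff IH IG ∞ φ
  map_act : ∀ r h, π (D.act r h) = B.act (π r) (φ h)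

namespace IsMorphism

variable {D : PrincipalBundle IH IR IM H R M} {B : PrincipalBundle IG IP IM G P M}
  {φ : H →* G} {π : R → P}

theorem mdifferentiableAt (hπ : D.IsMorphism B φ π) (r : R) : MDifferentiableAt IR IP π r :=
  hπ.contMDiff.mdifferentiable (by simp) r

theorem mdifferentiableAt_hom (hπ : D.IsMorphism B φ π) (h : H) : MDifferentiableAt IH IG φ h :=
  hπ.contMDiff_hom.mdifferentiable (by simp) h

/-- Differentiate `π(r · a) = π(r) · φ(a)` in `a` at `1`. The next two lemmas differentiate the same
identity in `r`, and `φ(h a h⁻¹) = φ(h) φ(a) φ(h)⁻¹` at `a = 1`. -/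
theorem mfderiv_fundamentalField (hπ : D.IsMorphism B φ π) (r : R) (ζ : EH) :
    (mfderiv IR IP π r (D.fundamentalField ζ r) : EP) =
      B.fundamentalField (mfderiv IH IG φ 1 ζ : EG) (π r) := by
  have h1 := mfderiv_comp_apply_of_eq (x := (1 : H)) (hπ.mdifferentiableAt r)
    (D.mdifferentiableAt_act_right r 1) (D.act_one r) ζ
  have h2 := mfderiv_comp_apply_of_eq (x := (1 : H)) (B.mdifferentiableAt_act_right (π r) 1)
    (hπ.mdifferentiableAt_hom 1) (map_one φ) ζ
  have he : π ∘ (fun a : H => D.act r a) = (fun g : G => B.act (π r) g) ∘ φ :=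
    funext fun a => hπ.map_act r a
  rw [he] at h1
  exact h1.symm.trans h2

theorem mfderiv_act (hπ : D.IsMorphism B φ π) (r : R) (h : H) (v : ER) :
    (mfderiv IR IP π (D.act r h) (mfderiv IR IR (fun x : R => D.act x h) r v : ER) : EP) =
      (mfderiv IP IP (fun x : P => B.act x (φ h)) (π r) (mfderiv IR IP π r v : EP) : EP) := by
  have h1 := mfderiv_comp_apply r (hπ.mdifferentiableAt (D.act r h))
    (D.mdifferentiableAt_act_left h r) v
  have h2 := mfderiv_comp_apply r (B.mdifferentiableAt_act_left (φ h) (π r))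
    (hπ.mdifferentiableAt r) v
  have he : π ∘ (fun x : R => D.act x h) = (fun x : P => B.act x (φ h)) ∘ π :=
    funext fun x => hπ.map_act x h
  rw [he] at h1
  exact h1.symm.trans h2

theorem mfderiv_lieAd [LieGroup IG ∞ G] [LieGroup IH ∞ H] (hπ : D.IsMorphism B φ π) (h : H)
    (ζ : EH) :
    (mfderiv IH IG φ 1 (lieAd IH h ζ : EH) : EG) =
      lieAd IG (φ h) (mfderiv IH IG φ 1 ζ : EG) := by
  have cH : MDifferentiableAt IH IH (fun a : H => h * a * h⁻¹) 1 :=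
    ((contMDiff_mul_right (I := IH) (n := ∞) (a := h⁻¹)).comp
      (contMDiff_mul_left (I := IH) (n := ∞) (a := h))).mdifferentiable (by simp) 1
  have cG : MDifferentiableAt IG IG (fun a : G => φ h * a * (φ h)⁻¹) 1 :=
    ((contMDiff_mul_right (I := IG) (n := ∞) (a := (φ h)⁻¹)).comp
      (contMDiff_mul_left (I := IG) (n := ∞) (a := φ h))).mdifferentiable (by simp) 1
  have h1 := mfderiv_comp_apply_of_eq (x := (1 : H)) (hπ.mdifferentiableAt_hom 1) cH (by simp) ζ
  have h2 := mfderiv_comp_apply_of_eq (x := (1 : H)) cG (hπ.mdifferentiableAt_hom 1)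
    (map_one φ) ζ
  have he : φ ∘ (fun a : H => h * a * h⁻¹) = (fun a : G => φ h * a * (φ h)⁻¹) ∘ φ := by
    funext a
    simp
  rw [he] at h1
  exact h1.symm.trans h2

end IsMorphism

end PrincipalBundle

/-! ### Connections evaluated on moving points and moving group elements. -/

namespace PrincipalConnection

variable [IsManifold IP ∞ P] [IsManifold IR ∞ R]

/-- Taking `v` in the model space allows the base point to be replaced by an equal one without
transporting `v` between tangent spaces. -/
theorem form_congr {B : PrincipalBundle IG IP IM G P M} (θ : PrincipalConnection B) {p p' : P}
    (h : p = p') (v : EP) : (θ.form p v : EG) = θ.form p' v := by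
  subst h
  rfl

/-- The value of a connection on the derivative of `z ↦ f z · a z`. -/
theorem form_mfderiv_act [LieGroup IG ∞ G] {B : PrincipalBundle IG IP IM G P M}
    (θ : PrincipalConnection B) {f : N → P} {a : N → G} {n : N}
    (hf : MDifferentiableAt IN IP f n) (ha : MDifferentiableAt IN IG a n) (v : EN) :
    (θ.form (B.act (f n) (a n)) (mfderiv IN IP (fun z => B.act (f z) (a z)) n v : EP) : EG) =
      (lieAd IG (a n)⁻¹ (θ.form (f n) (mfderiv IN IP f n v : EP)) : EG) +
      maurerCartan IG (a n) (mfderiv IN IG a n v : EG) := by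
  -- Of the two Leibniz terms, the first is a right translate, handled by equivariance; the second
  -- is a fundamental vector, handled by normalisation.
  rw [B.mfderiv_act_apply hf ha v]
  refine (map_add (θ.form (B.act (f n) (a n))) _ _).trans ?_
  congr 1
  · exact θ.equivariant _ _ _
  · exact (congrArg (θ.form (B.act (f n) (a n)) : EP →L[ℝ] EG)
      (B.mfderiv_orbit_apply (f n) (a n) _)).trans (θ.normalised _ _)

end PrincipalConnection

/-! ### Local splittings and descent of connections. -/

namespace PrincipalBundle

/-- A splitting over `U` of a morphism `π : R → P` of principal bundles: a smooth section `σ` of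
`π`, and a smooth map `κ` to the kernel of `φ` that takes `σ (π r)` to `r`. -/
structure IsLocalSplitting (D : PrincipalBundle IH IR IM H R M) (IP : ModelWithCorners ℝ EP HP)
    (φ : H →* G) (π : R → P) (U : Set P) (σ : P → R) (κ : R → H) : Prop where
  isOpen : IsOpen U
  contMDiffOn_section : ContMDiffOn IP IR ∞ σ U
  map_section : ∀ p ∈ U, π (σ p) = p
  contMDiffOn_gauge : ContMDiffOn IR IH ∞ κ (π ⁻¹' U)
  hom_gauge : ∀ r, π r ∈ U → φ (κ r) = 1
  act_gauge : ∀ r, π r ∈ U → D.act (σ (π r)) (κ r) = r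

namespace IsLocalSplitting

variable {D : PrincipalBundle IH IR IM H R M} {B : PrincipalBundle IG IP IM G P M}
  {φ : H →* G} {π : R → P} {U : Set P} {σ : P → R} {κ : R → H}

set_option linter.unusedSectionVars false in
theorem mdifferentiableAt_section (S : D.IsLocalSplitting IP φ π U σ κ) {p : P} (hp : p ∈ U) :
    MDifferentiableAt IP IR σ p :=
  (S.contMDiffOn_section.contMDiffAt (S.isOpen.mem_nhds hp)).mdifferentiableAt (by simp)

theorem mfderiv_mfderiv_section (S : D.IsLocalSplitting IP φ π U σ κ) (hπ : D.IsMorphism B φ π)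
    {p : P} (hp : p ∈ U) (w : EP) :
    (mfderiv IR IP π (σ p) (mfderiv IP IR σ p w : ER) : EP) = w := by
  have h := mfderiv_comp_apply p (hπ.mdifferentiableAt (σ p)) (S.mdifferentiableAt_section hp) w
  have he : π ∘ σ =ᶠ[nhds p] id :=
    Filter.eventually_of_mem (S.isOpen.mem_nhds hp) S.map_section
  rw [he.mfderiv_eq, mfderiv_id] at h
  exact h.symm

/-- The descent identity: the right side sees `v` only through `dπ v`. Differentiating `r = σ(π r) ·
κ(r)` produces an adjoint factor and a Maurer-Cartan term, both neutralised by `dφ` because `κ`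
takes values in `ker φ`. -/
theorem hom_form_eq [LieGroup IG ∞ G] [LieGroup IH ∞ H] [IsManifold IR ∞ R]
    (S : D.IsLocalSplitting IP φ π U σ κ) (hπ : D.IsMorphism B φ π) (Ω : PrincipalConnection D)
    {r : R} (hr : π r ∈ U) (v : ER) :
    (mfderiv IH IG φ 1 (Ω.form r v : EH) : EG) =
      (mfderiv IH IG φ 1 (Ω.form (σ (π r))
        (mfderiv IP IR σ (π r) (mfderiv IR IP π r v : EP) : ER) : EH) : EG) := by
  have hW : π ⁻¹' U ∈ nhds r := (S.isOpen.preimage hπ.contMDiff.continuous).mem_nhds hr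
  have hκ : MDifferentiableAt IR IH κ r :=
    (S.contMDiffOn_gauge.contMDiffAt hW).mdifferentiableAt (by simp)
  have hσ := S.mdifferentiableAt_section hr
  have h := Ω.form_mfderiv_act (hσ.comp r (hπ.mdifferentiableAt r)) hκ v
  have he : (fun z => D.act ((σ ∘ π) z) (κ z)) =ᶠ[nhds r] id :=
    Filter.eventually_of_mem hW S.act_gauge
  rw [he.mfderiv_eq, mfderiv_id, mfderiv_comp r hσ (hπ.mdifferentiableAt r)] at h
  -- The Maurer-Cartan term is the derivative at `r` of `z ↦ κ(r)⁻¹ κ(z)`, which `φ` sends to the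
  -- constant `1` near `r`.
  have h0 : (mfderiv IH IG φ 1 (maurerCartan IH (κ r) (mfderiv IR IH κ r v : EH) : EH) : EG)
      = 0 := by
    have hL := mdifferentiableAt_leftMul (IG := IH) (κ r)⁻¹ (κ r)
    have k1 := mfderiv_comp_apply r hL hκ v
    have k2 := mfderiv_comp_apply_of_eq (x := r) (y := (1 : H)) (hπ.mdifferentiableAt_hom 1)
      (hL.comp r hκ) (by simp) v
    have k3 : φ ∘ ((fun b : H => (κ r)⁻¹ * b) ∘ κ) =ᶠ[nhds r] fun _ => 1 := by
      filter_upwards [hW] with z hz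
      simp [S.hom_gauge z hz, S.hom_gauge r hr]
    rw [k3.mfderiv_eq, mfderiv_const, k1] at k2
    exact k2.symm
  have h1 := (Ω.form_congr (S.act_gauge r hr) v).symm.trans h
  refine (congrArg (mfderiv IH IG φ 1 : EH →L[ℝ] EG) h1).trans ?_
  refine (map_add (mfderiv IH IG φ 1 : EH →L[ℝ] EG) _ _).trans ?_
  refine (congrArg₂ (fun a b : EG => a + b) ((hπ.mfderiv_lieAd _ _).trans ?_) h0).trans
    (add_zero _)
  rw [map_inv, S.hom_gauge r hr, inv_one]
  exact lieAd_one _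

end IsLocalSplitting

/-- A connection is determined by its pullback along a morphism with local splittings. -/
theorem IsMorphism.connection_ext [IsManifold IP ∞ P]
    {D : PrincipalBundle IH IR IM H R M} {B : PrincipalBundle IG IP IM G P M}
    {φ : H →* G} {π : R → P} (hπ : D.IsMorphism B φ π)
    (hloc : ∀ p, ∃ U σ κ, p ∈ U ∧ D.IsLocalSplitting IP φ π U σ κ)
    {θ θ' : PrincipalConnection B}
    (h : ∀ (r : R) (v : ER), (θ.form (π r) (mfderiv IR IP π r v : EP) : EG) =
      θ'.form (π r) (mfderiv IR IP π r v : EP)) : θ = θ' := by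
  refine PrincipalConnection.ext (funext fun p => ContinuousLinearMap.ext fun w => ?_)
  obtain ⟨U, σ, κ, hp, S⟩ := hloc p
  -- Every `w` at `p` is `dπ` of the vector `dσ w` at `σ p`, so the pullbacks determine the
  -- connections.
  have k := h (σ p) (mfderiv IP IR σ p w : ER)
  rwa [S.mfderiv_mfderiv_section hπ hp w, S.map_section p hp] at k

/-- Along a morphism with local splittings and a split group homomorphism, every connection
pushes forward. -/
theorem IsMorphism.exists_pushforward [LieGroup IG ∞ G] [LieGroup IH ∞ H] [IsManifold IP ∞ P]
    [IsManifold IR ∞ R] [IP.Boundaryless]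
    {D : PrincipalBundle IH IR IM H R M} {B : PrincipalBundle IG IP IM G P M}
    {φ : H →* G} {π : R → P} (hπ : D.IsMorphism B φ π)
    (hloc : ∀ p, ∃ U σ κ, p ∈ U ∧ D.IsLocalSplitting IP φ π U σ κ)
    {ι : G →* H} (hι : ContMDiff IG IH ∞ ι) (hφι : ∀ g, φ (ι g) = g)
    (Ω : PrincipalConnection D) :
    ∃ θ : PrincipalConnection B, ∀ (r : R) (v : ER),
      (θ.form (π r) (mfderiv IR IP π r v : EP) : EG) =
        (mfderiv IH IG φ 1 (Ω.form r v : EH) : EG) := by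
  choose U σ κ hU S using hloc
  -- Each point uses its own chosen splitting; the descent identity `key` makes the value
  -- independent of that choice.
  let form : P → EP →L[ℝ] EG := fun p =>
    (mfderiv IH IG φ 1 : EH →L[ℝ] EG).comp
      ((Ω.form (σ p p) : ER →L[ℝ] EH).comp (mfderiv IP IR (σ p) p : EP →L[ℝ] ER))
  have key : ∀ (r : R) (v : ER), form (π r) (mfderiv IR IP π r v : EP) =
      (mfderiv IH IG φ 1 (Ω.form r v : EH) : EG) := fun r v =>
    ((S (π r)).hom_form_eq hπ Ω (hU (π r)) v).symm
  have local_eq : ∀ p₀, ∀ p ∈ U p₀, ∀ w : EP, form p w =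
      (mfderiv IH IG φ 1 (Ω.form (σ p₀ p) (mfderiv IP IR (σ p₀) p w : ER) : EH) : EG) := by
    intro p₀ p hp w
    have h := key (σ p₀ p) (mfderiv IP IR (σ p₀) p w : ER)
    rwa [(S p₀).mfderiv_mfderiv_section hπ hp w, (S p₀).map_section p hp] at h
  have dsurj : ∀ p, ∃ r, π r = p ∧ ∀ w : EP, ∃ v : ER, (mfderiv IR IP π r v : EP) = w :=
    fun p => ⟨σ p p, (S p).map_section p (hU p), fun w =>
      ⟨mfderiv IP IR (σ p) p w, (S p).mfderiv_mfderiv_section hπ (hU p) w⟩⟩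
  refine ⟨⟨form, ?_, ?_, ?_⟩, key⟩
  -- Near `v₀` a single section serves for all points by `local_eq`, so the form is the composite of
  -- the tangent map of that section, `Ω` and `dφ`.
  · intro v₀
    have hs := (S v₀.1).contMDiffOn_section.contMDiffOn_tangentMapWithin (m := ∞) (by simp)
      (S v₀.1).isOpen.uniqueMDiffOn
    have hΩ := Ω.contMDiff_form.comp_contMDiffOn hs
    have hc := (ContinuousLinearMap.contMDiff (E := EH) (F := EG) (n := ∞)
      (mfderiv IH IG φ 1)).comp_contMDiffOn hΩ
    have hopen : IsOpen (Bundle.TotalSpace.proj ⁻¹' U v₀.1 : Set (TangentBundle IP P)) :=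
      (S v₀.1).isOpen.preimage (FiberBundle.continuous_proj EP (TangentSpace IP (M := P)))
    refine (hc.congr fun v hv => ?_).contMDiffAt (hopen.mem_nhds (hU v₀.1))
    refine (local_eq v₀.1 v.1 hv v.2).trans ?_
    rw [← mfderivWithin_of_isOpen (f := σ v₀.1) (S v₀.1).isOpen hv]
    rfl
  · intro p ξ
    obtain ⟨r, rfl, -⟩ := dsurj p
    -- As `dφ (dι ξ) = ξ`, the fundamental vector of `ξ` on `P` is the image of that of `dι ξ` on
    -- `R`, where `Ω` is normalised.
    have h1 : (mfderiv IH IG φ 1 (mfderiv IG IH ι 1 ξ : EH) : EG) = ξ := by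
      have h := mfderiv_comp_apply_of_eq (x := (1 : G)) (y := (1 : H))
        (hπ.mdifferentiableAt_hom 1) (hι.mdifferentiable (by simp) 1) (map_one ι) ξ
      have he : φ ∘ ι = id := funext hφι
      rw [he, mfderiv_id] at h
      exact h.symm
    have h2 := hπ.mfderiv_fundamentalField r (mfderiv IG IH ι 1 ξ : EH)
    rw [h1] at h2
    refine (congrArg (form (π r)) h2.symm).trans ((key r _).trans ?_)
    exact (congrArg (mfderiv IH IG φ 1 : EH →L[ℝ] EG) (Ω.normalised r _)).trans h1
  · intro g p v
    obtain ⟨r, rfl, hr⟩ := dsurj p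
    obtain ⟨u, rfl⟩ := hr v
    -- Translation by `g` on `P` lifts to translation by `ι g` on `R`, so equivariance is inherited
    -- from `Ω` by applying `dφ`.
    have h1 := hπ.mfderiv_act r (ι g) u
    have h2 := key (D.act r (ι g)) (mfderiv IR IR (fun x : R => D.act x (ι g)) r u : ER)
    rw [h1, hπ.map_act, hφι] at h2
    refine h2.trans ((congrArg (mfderiv IH IG φ 1 : EH →L[ℝ] EG) (Ω.equivariant _ _ _)).trans
      ((hπ.mfderiv_lieAd _ _).trans ?_))
    rw [map_inv, hφι]
    exact congrArg (lieAd IG g⁻¹ : EG →L[ℝ] EG) (key r u).symm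

end PrincipalBundle

end PrincipalConnections

/-! ### The projections of `P ×_M Q` and their local splittings. -/

section FibreProductConnections

variable {EG HG EK HK EP HP EQ HQ EM HM : Type*}
  [NormedAddCommGroup EG] [NormedSpace ℝ EG] [TopologicalSpace HG]
  [NormedAddCommGroup EK] [NormedSpace ℝ EK] [TopologicalSpace HK]
  [NormedAddCommGroup EP] [NormedSpace ℝ EP] [TopologicalSpace HP]
  [NormedAddCommGroup EQ] [NormedSpace ℝ EQ] [TopologicalSpace HQ]
  [NormedAddCommGroup EM] [NormedSpace ℝ EM] [TopologicalSpace HM]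
  {IG : ModelWithCorners ℝ EG HG} {IK : ModelWithCorners ℝ EK HK}
  {IP : ModelWithCorners ℝ EP HP} {IQ : ModelWithCorners ℝ EQ HQ}
  {IM : ModelWithCorners ℝ EM HM}
  {G K P Q M : Type*}
  [TopologicalSpace G] [ChartedSpace HG G] [Group G]
  [TopologicalSpace K] [ChartedSpace HK K] [Group K]
  [TopologicalSpace P] [ChartedSpace HP P]
  [TopologicalSpace Q] [ChartedSpace HQ Q]
  [TopologicalSpace M] [ChartedSpace HM M]

theorem mfderiv_monoidHom_fst (ξ : EG × EK) :
    (mfderiv (IG.prod IK) IG (MonoidHom.fst G K) 1 ξ : EG) = ξ.1 :=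
  congrArg (fun f : EG × EK →L[ℝ] EG => f ξ) mfderiv_fst

theorem mfderiv_monoidHom_snd (ξ : EG × EK) :
    (mfderiv (IG.prod IK) IK (MonoidHom.snd G K) 1 ξ : EK) = ξ.2 :=
  congrArg (fun f : EG × EK →L[ℝ] EK => f ξ) mfderiv_snd

/-- Equivariance controls only the group coordinate; as the action preserves fibres, the base
coordinate is fixed too, and the two determine the point. -/
theorem IsPrincipalTriv.act_symm {B : PrincipalBundle IG IP IM G P M}
    {e : Bundle.Trivialization G B.proj} (h : IsPrincipalTriv IG IP IM B.act e) {m : M}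
    (hm : m ∈ e.baseSet) (g a : G) :
    B.act (e.toOpenPartialHomeomorph.symm (m, g)) a =
      e.toOpenPartialHomeomorph.symm (m, g * a) := by
  have hp := e.proj_symm_apply' (x := g) hm
  have hs : e.toOpenPartialHomeomorph.symm (m, g) ∈ e.source :=
    e.mem_source.2 (hp.symm ▸ hm)
  have hs' : B.act (e.toOpenPartialHomeomorph.symm (m, g)) a ∈ e.source :=
    e.mem_source.2 (by rw [B.proj_act, hp]; exact hm)
  have h1 := h.equivariant _ hs a
  rw [e.apply_symm_apply' hm] at h1
  have h2 := e.symm_apply_mk_proj hs'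
  rw [h1, B.proj_act, hp] at h2
  exact h2.symm

theorem PrincipalConnection.contMDiff_pullback {ER HR R : Type*}
    [NormedAddCommGroup ER] [NormedSpace ℝ ER] [TopologicalSpace HR]
    {IR : ModelWithCorners ℝ ER HR} [TopologicalSpace R] [ChartedSpace HR R]
    [IsManifold IR ∞ R] [IsManifold IP ∞ P]
    {B : PrincipalBundle IG IP IM G P M} (θ : PrincipalConnection B)
    {π : R → P} (hπ : ContMDiff IR IP ∞ π) :
    ContMDiff (M' := EG) IR.tangent 𝓘(ℝ, EG) ∞
      (fun v : TangentBundle IR R => pullbackForm IR IP π θ.form v.1 v.2) :=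
  θ.contMDiff_form.comp (hπ.contMDiff_tangentMap (m := ∞) (by simp))

variable [IsManifold IM ∞ M] [LieGroup IG ∞ G] [LieGroup IK ∞ K]

namespace FibreProduct

theorem isMorphism_fst (B : PrincipalBundle IG IP IM G P M)
    (C : PrincipalBundle IK IQ IM K Q M) :
    (B.fibreProduct C).IsMorphism B (MonoidHom.fst G K) FibreProduct.fst where
  contMDiff := FibreProduct.contMDiff_fst
  contMDiff_hom := _root_.contMDiff_fst
  map_act _ _ := rfl

theorem isMorphism_snd (B : PrincipalBundle IG IP IM G P M)
    (C : PrincipalBundle IK IQ IM K Q M) :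
    (B.fibreProduct C).IsMorphism C (MonoidHom.snd G K) FibreProduct.snd where
  contMDiff := FibreProduct.contMDiff_snd
  contMDiff_hom := _root_.contMDiff_snd
  map_act _ _ := rfl

theorem exists_splitting_fst (B : PrincipalBundle IG IP IM G P M)
    (C : PrincipalBundle IK IQ IM K Q M) (p : P) :
    ∃ U σ κ, p ∈ U ∧ (B.fibreProduct C).IsLocalSplitting IP (MonoidHom.fst G K)
      FibreProduct.fst U σ κ := by
  obtain ⟨e, he, h⟩ := B.exists_triv (B.proj p)
  obtain ⟨e', he', h'⟩ := C.exists_triv (B.proj p)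
  have hopen := (e.open_baseSet.inter e'.open_baseSet).preimage B.contMDiff_proj.continuous
  -- The section pairs `p` with the point of `Q` over `π_P p` whose `K`-coordinate is `1`; acting by
  -- the `K`-coordinate of `q` then recovers `q`.
  refine ⟨B.proj ⁻¹' (e.baseSet ∩ e'.baseSet),
    fun x => trivInv e e' (B.proj x, ((e x).2, 1)), fun x => (1, (e' x.snd).2), ⟨he, he'⟩,
    hopen, ?_, ?_, ?_, fun _ _ => rfl, ?_⟩
  · have h1 := _root_.contMDiff_snd.comp_contMDiffOn (h.contMDiffOn.mono
      (fun x (hx : B.proj x ∈ e.baseSet ∩ e'.baseSet) => e.mem_source.2 hx.1))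
    exact (contMDiffOn_triv_symm h h').comp
      (B.contMDiff_proj.contMDiffOn.prodMk (h1.prodMk contMDiffOn_const))
      (fun x hx => (triv e e').mem_target.2 hx)
  · intro x hx
    rw [fst_trivInv e e' (by exact hx)]
    exact e.symm_apply_mk_proj (e.mem_source.2 hx.1)
  · exact contMDiffOn_const.prodMk (_root_.contMDiff_snd.comp_contMDiffOn
      (h'.contMDiffOn.comp FibreProduct.contMDiff_snd.contMDiffOn
        (fun x hx => e'.mem_source.2 (x.proj_eq ▸ hx.2))))
  · intro x hx
    refine FibreProduct.ext ?_ ?_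
    · change B.act (trivInv e e' _).fst 1 = _
      rw [B.act_one, fst_trivInv e e' (by exact hx)]
      exact e.symm_apply_mk_proj (e.mem_source.2 hx.1)
    · change C.act (trivInv e e' _).snd _ = _
      rw [snd_trivInv e e' (by exact hx), h'.act_symm hx.2, one_mul, x.proj_eq]
      exact e'.symm_apply_mk_proj (e'.mem_source.2 (x.proj_eq ▸ hx.2))

theorem exists_splitting_snd (B : PrincipalBundle IG IP IM G P M)
    (C : PrincipalBundle IK IQ IM K Q M) (q : Q) :
    ∃ U σ κ, q ∈ U ∧ (B.fibreProduct C).IsLocalSplitting IQ (MonoidHom.snd G K)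
      FibreProduct.snd U σ κ := by
  obtain ⟨e, he, h⟩ := B.exists_triv (C.proj q)
  obtain ⟨e', he', h'⟩ := C.exists_triv (C.proj q)
  have hopen := (e.open_baseSet.inter e'.open_baseSet).preimage C.contMDiff_proj.continuous
  -- The mirror choice: the unit section of `P`, corrected by the `G`-coordinate of `p`.
  refine ⟨C.proj ⁻¹' (e.baseSet ∩ e'.baseSet),
    fun x => trivInv e e' (C.proj x, (1, (e' x).2)), fun x => ((e x.fst).2, 1), ⟨he, he'⟩,
    hopen, ?_, ?_, ?_, fun _ _ => rfl, ?_⟩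
  · have h1 := _root_.contMDiff_snd.comp_contMDiffOn (h'.contMDiffOn.mono
      (fun x (hx : C.proj x ∈ e.baseSet ∩ e'.baseSet) => e'.mem_source.2 hx.2))
    exact (contMDiffOn_triv_symm h h').comp
      (C.contMDiff_proj.contMDiffOn.prodMk (contMDiffOn_const.prodMk h1))
      (fun x hx => (triv e e').mem_target.2 hx)
  · intro x hx
    rw [snd_trivInv e e' (by exact hx)]
    exact e'.symm_apply_mk_proj (e'.mem_source.2 hx.2)
  · exact (_root_.contMDiff_snd.comp_contMDiffOn
      (h.contMDiffOn.comp FibreProduct.contMDiff_fst.contMDiffOn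
        (fun x (hx : C.proj x.snd ∈ e.baseSet ∩ e'.baseSet) =>
          e.mem_source.2 (x.proj_eq ▸ hx.1)))).prodMk contMDiffOn_const
  · intro x hx
    refine FibreProduct.ext ?_ ?_
    · change B.act (trivInv e e' _).fst _ = _
      rw [fst_trivInv e e' (by exact hx), h.act_symm hx.1, one_mul, ← x.proj_eq]
      exact e.symm_apply_mk_proj (e.mem_source.2 (x.proj_eq ▸ hx.1))
    · change C.act (trivInv e e' _).snd 1 = _
      rw [C.act_one, snd_trivInv e e' (by exact hx)]
      exact e'.symm_apply_mk_proj (e'.mem_source.2 hx.2)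

end FibreProduct

/-! ### The connection on the fibre product. -/

namespace PrincipalConnection

variable [IsManifold IP ∞ P] [IsManifold IQ ∞ Q]

/-- The connection on `P ×_M Q` whose components are the pullbacks of connections on `P` and
`Q`. -/
def fibreProduct {B : PrincipalBundle IG IP IM G P M} {C : PrincipalBundle IK IQ IM K Q M}
    (θ : PrincipalConnection B) (A : PrincipalConnection C) :
    PrincipalConnection (B.fibreProduct C) where
  form x := ((pullbackForm (IM.prod (IG.prod IK)) IP FibreProduct.fst θ.form x :
      EM × EG × EK →L[ℝ] EG).prod
    (pullbackForm (IM.prod (IG.prod IK)) IQ FibreProduct.snd A.form x :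
      EM × EG × EK →L[ℝ] EK) : EM × EG × EK →L[ℝ] EG × EK)
  contMDiff_form := (θ.contMDiff_pullback FibreProduct.contMDiff_fst).prodMk_space
    (A.contMDiff_pullback FibreProduct.contMDiff_snd)
  normalised x ξ := by
    refine Prod.ext ?_ ?_
    · refine (congrArg (θ.form x.fst : EP →L[ℝ] EG)
        ((FibreProduct.isMorphism_fst B C).mfderiv_fundamentalField x ξ)).trans
        ((θ.normalised _ _).trans ?_)
      exact mfderiv_monoidHom_fst (IG := IG) (IK := IK) (G := G) (K := K) ξ
    · refine (congrArg (A.form x.snd : EQ →L[ℝ] EK)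
        ((FibreProduct.isMorphism_snd B C).mfderiv_fundamentalField x ξ)).trans
        ((A.normalised _ _).trans ?_)
      exact mfderiv_monoidHom_snd (IG := IG) (IK := IK) (G := G) (K := K) ξ
  equivariant a x v := by
    refine Prod.ext ?_ ?_
    · have h1 := congrArg (θ.form (B.act x.fst a.1) : EP →L[ℝ] EG)
        ((FibreProduct.isMorphism_fst B C).mfderiv_act x a v)
      refine (h1.trans (θ.equivariant _ _ _)).trans ?_
      -- The adjoint action of `G × K` is not a pair by definition; its `𝔤`-component is found by
      -- applying `mfderiv_lieAd` to the projection homomorphism.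
      refine Eq.trans ?_ (mfderiv_monoidHom_fst (IG := IG) (IK := IK) (G := G) (K := K) _)
      refine Eq.trans ?_ ((FibreProduct.isMorphism_fst B C).mfderiv_lieAd a⁻¹ _).symm
      exact congrArg (lieAd IG a.1⁻¹ : EG →L[ℝ] EG)
        (mfderiv_monoidHom_fst (IG := IG) (IK := IK) (G := G) (K := K)
          (pullbackForm (IM.prod (IG.prod IK)) IP FibreProduct.fst θ.form x v,
            pullbackForm (IM.prod (IG.prod IK)) IQ FibreProduct.snd A.form x v)).symm
    · have h1 := congrArg (A.form (C.act x.snd a.2) : EQ →L[ℝ] EK)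
        ((FibreProduct.isMorphism_snd B C).mfderiv_act x a v)
      refine (h1.trans (A.equivariant _ _ _)).trans ?_
      refine Eq.trans ?_ (mfderiv_monoidHom_snd (IG := IG) (IK := IK) (G := G) (K := K) _)
      refine Eq.trans ?_ ((FibreProduct.isMorphism_snd B C).mfderiv_lieAd a⁻¹ _).symm
      exact congrArg (lieAd IK a.2⁻¹ : EK →L[ℝ] EK)
        (mfderiv_monoidHom_snd (IG := IG) (IK := IK) (G := G) (K := K)
          (pullbackForm (IM.prod (IG.prod IK)) IP FibreProduct.fst θ.form x v,
            pullbackForm (IM.prod (IG.prod IK)) IQ FibreProduct.snd A.form x v)).symm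

end PrincipalConnection

end FibreProductConnections

end

theorem mainTheorem7
    {EG HG EK HK EP HP EQ HQ EM HM : Type*}
    [NormedAddCommGroup EG] [NormedSpace ℝ EG] [FiniteDimensional ℝ EG] [TopologicalSpace HG]
    [NormedAddCommGroup EK] [NormedSpace ℝ EK] [FiniteDimensional ℝ EK] [TopologicalSpace HK]
    [NormedAddCommGroup EP] [NormedSpace ℝ EP] [FiniteDimensional ℝ EP] [TopologicalSpace HP]
    [NormedAddCommGroup EQ] [NormedSpace ℝ EQ] [FiniteDimensional ℝ EQ] [TopologicalSpace HQ]
    [NormedAddCommGroup EM] [NormedSpace ℝ EM] [FiniteDimensional ℝ EM] [TopologicalSpace HM]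
    (IG : ModelWithCorners ℝ EG HG) [IG.Boundaryless]
    (IK : ModelWithCorners ℝ EK HK) [IK.Boundaryless]
    (IP : ModelWithCorners ℝ EP HP) [IP.Boundaryless]
    (IQ : ModelWithCorners ℝ EQ HQ) [IQ.Boundaryless]
    (IM : ModelWithCorners ℝ EM HM) [IM.Boundaryless]
    {G K P Q M : Type*}
    [TopologicalSpace G] [ChartedSpace HG G] [Group G] [LieGroup IG ∞ G]
    [TopologicalSpace K] [ChartedSpace HK K] [Group K] [LieGroup IK ∞ K]
    [TopologicalSpace P] [ChartedSpace HP P] [IsManifold IP ∞ P]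
    [TopologicalSpace Q] [ChartedSpace HQ Q] [IsManifold IQ ∞ Q]
    [TopologicalSpace M] [ChartedSpace HM M] [IsManifold IM ∞ M]
    (B : PrincipalBundle IG IP IM G P M) (C : PrincipalBundle IK IQ IM K Q M) :
    ∃ Φ : PrincipalConnection B × PrincipalConnection C ≃ PrincipalConnection (B.fibreProduct C),
      ∀ (θ : PrincipalConnection B) (A : PrincipalConnection C) (x : FibreProduct B C),
        (lieFst IG IK G K).comp ((Φ (θ, A)).form x) =
            pullbackForm (IM.prod (IG.prod IK)) IP FibreProduct.fst θ.form x ∧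
        (lieSnd IG IK G K).comp ((Φ (θ, A)).form x) =
            pullbackForm (IM.prod (IG.prod IK)) IQ FibreProduct.snd A.form x := by
  refine ⟨Equiv.ofBijective (fun z => z.1.fibreProduct z.2) ⟨?_, ?_⟩, fun θ A x => ⟨?_, ?_⟩⟩
  · rintro ⟨θ, A⟩ ⟨θ', A'⟩ h
    have hx : ∀ x v, ((θ.fibreProduct A).form x v : EG × EK) = (θ'.fibreProduct A').form x v :=
      fun x v => congrArg (fun Ω : PrincipalConnection (B.fibreProduct C) => Ω.form x v) h
    exact Prod.ext
      ((FibreProduct.isMorphism_fst B C).connection_ext (FibreProduct.exists_splitting_fst B C)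
        fun x v => congrArg Prod.fst (hx x v))
      ((FibreProduct.isMorphism_snd B C).connection_ext (FibreProduct.exists_splitting_snd B C)
        fun x v => congrArg Prod.snd (hx x v))
  · intro Ω
    -- Surjectivity: push `Ω` forward along each projection, splitting the group homomorphisms by `g
    -- ↦ (g, 1)` and `k ↦ (1, k)`; the two pushforwards pull back to the components of `Ω`.
    obtain ⟨θ, hθ⟩ := (FibreProduct.isMorphism_fst B C).exists_pushforward
      (FibreProduct.exists_splitting_fst B C) (ι := MonoidHom.inl G K)
      (contMDiff_id.prodMk contMDiff_const) (fun _ => rfl) Ω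
    obtain ⟨A, hA⟩ := (FibreProduct.isMorphism_snd B C).exists_pushforward
      (FibreProduct.exists_splitting_snd B C) (ι := MonoidHom.inr G K)
      (contMDiff_const.prodMk contMDiff_id) (fun _ => rfl) Ω
    refine ⟨(θ, A), PrincipalConnection.ext (funext fun x => ContinuousLinearMap.ext fun v => ?_)⟩
    exact Prod.ext
      ((hθ x v).trans (mfderiv_monoidHom_fst (IG := IG) (IK := IK) (G := G) (K := K) (Ω.form x v)))
      ((hA x v).trans (mfderiv_monoidHom_snd (IG := IG) (IK := IK) (G := G) (K := K) (Ω.form x v)))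
  · exact ContinuousLinearMap.ext fun v => mfderiv_monoidHom_fst (IG := IG) (IK := IK) (G := G) (K := K)
      ((θ.fibreProduct A).form x v)
  · exact ContinuousLinearMap.ext fun v => mfderiv_monoidHom_snd (IG := IG) (IK := IK) (G := G) (K := K)
      ((θ.fibreProduct A).form x v)
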